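/- For a field $\mathbb{F}$ and $m\in\mathbb{N}$, let $\mathbf{PG}(m,\mathbb{F})$ be the projective space whose points and lines are the one- and two-dimensional linear subspaces of $\mathbb{F}^{m+1}$. An automorphism of $\mathbf{PG}(m,\mathbb{F})$ is a permutation of its points which, together with its inverse, maps lines onto lines; a Singer group of $\mathbf{PG}(m,\mathbb{F})$ is a group $S$ of automorphisms that acts sharply transitively on the points, i.e. for all points $p,q$ there is exactly one $g\in S$ with $g(p)=q$. Let $\mathbb{F}$ be a real-closed field such that $|\mathrm{Aut}(\mathbb{F})|<|\mathbb{F}|$ (as cardinal numbers), where $\mathrm{Aut}(\mathbb{F})$ is the group of field automorphisms of $\mathbb{F}$, and let $n\ge 3$ be an odd integer. Then $\mathbf{PG}(n-1,\mathbb{F})$ has no Singer group. In particular, $\mathbf{PG}(2,\mathbb{R})$ has no Singer group and, more generally, $\mathbf{PG}(m,\mathbb{R})$ has no Singer group for any even integer $m\ge 2$. -/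

import Mathlib

open scoped LinearAlgebra.Projectivization

/-- A line of the projective space `ℙ K V`: the set of points contained in a fixed
two-dimensional vector subspace `W` of `V`. -/
def IsProjLine {K V : Type*} [Field K] [AddCommGroup V] [Module K V] (L : Set (ℙ K V)) : Prop :=
  ∃ W : Submodule K V, Module.finrank K W = 2 ∧ L = {p | p.submodule ≤ W}

/-- The automorphism group of the point-line geometry `ℙ K V`: the permutations of the points
that, together with their inverses, map lines onto lines. -/
def projAut (K V : Type*) [Field K] [AddCommGroup V] [Module K V] :
    Subgroup (Equiv.Perm (ℙ K V)) where
  carrier := {f | ∀ L : Set (ℙ K V), IsProjLine (f '' L) ↔ IsProjLine L}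
  mul_mem' := by
    intro f g hf hg L
    rw [Equiv.Perm.coe_mul, Set.image_comp]
    exact (hf _).trans (hg L)
  one_mem' := by
    intro L
    simp
  inv_mem' := by
    intro f hf L
    rw [← hf (⇑f⁻¹ '' L), ← Set.image_comp, ← Equiv.Perm.coe_mul]
    simp

/-- A group `S` of automorphisms of `ℙ K V` is a Singer group if it acts sharply transitively on
the points: for all points `p`, `q` exactly one element of `S` maps `p` to `q`. -/
def IsSingerGroup {K V : Type*} [Field K] [AddCommGroup V] [Module K V]
    (S : Subgroup (projAut K V)) : Prop :=
  ∀ p q : ℙ K V, ∃! g : projAut K V, g ∈ S ∧ (g : Equiv.Perm (ℙ K V)) p = q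

/-- The projective space `PG(m, F)` of (projective) dimension `m`, that is, the projective space
of the vector space `F ^ (m + 1)`, admits a Singer group. -/
def PGHasSingerGroup (m : ℕ) (F : Type*) [Field F] : Prop :=
  ∃ S : Subgroup (projAut F (Fin (m + 1) → F)), IsSingerGroup S

/-! Fix a base point and let `s q` be the element of the Singer group taking it to `q`. By the
fundamental theorem of projective geometry, each `s q` is induced by a semilinear bijection with a
companion automorphism of the field. If `s q` and `s q'` share a companion, the quotient of their
semilinear maps is linear on a space of odd dimension; its characteristic polynomial has odd degree,
hence a root, and an eigenvector gives a point where `s q` and `s q'` agree. Sharp transitivity then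
forces `q = q'`. So distinct points have distinct companions, impossible as there are at least `|F|`
points and fewer automorphisms. For the fundamental theorem, `exists_affineChart` normalises
representatives of image points relative to a hyperplane; incidence then makes the resulting `φ`
additive and semilinear. -/

section FundamentalTheorem

variable {F V : Type*} [Field F] [AddCommGroup V] [Module F V]

/-- The permutation `f` of the points maps the point spanned by `x` to the point spanned by `y`. -/
def MapsVec (f : Equiv.Perm (ℙ F V)) (x y : V) : Prop :=
  ∃ (hx : x ≠ 0) (hy : y ≠ 0), f (Projectivization.mk F x hx) = Projectivization.mk F y hy

/-! ### Collineations acting on representative vectors -/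

namespace MapsVec

variable {f : Equiv.Perm (ℙ F V)} {x y x' y' x₁ x₂ y₁ y₂ : V}

theorem exists_right (f : Equiv.Perm (ℙ F V)) (hx : x ≠ 0) : ∃ y, MapsVec f x y :=
  ⟨(f (Projectivization.mk F x hx)).rep, hx, Projectivization.rep_nonzero _,
    (Projectivization.mk_rep _).symm⟩

theorem inv (h : MapsVec f x y) : MapsVec f⁻¹ y x := by
  obtain ⟨hx, hy, h⟩ := h
  exact ⟨hy, hx, by rw [← h]; simp⟩

theorem exists_left (f : Equiv.Perm (ℙ F V)) (hy : y ≠ 0) : ∃ x, MapsVec f x y := by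
  obtain ⟨x, hx⟩ := exists_right f⁻¹ hy
  exact ⟨x, by simpa using hx.inv⟩

theorem left_ne_zero (h : MapsVec f x y) : x ≠ 0 := h.1

theorem right_ne_zero (h : MapsVec f x y) : y ≠ 0 := h.2.1

theorem smul_right (h : MapsVec f x y) {c : F} (hc : c ≠ 0) : MapsVec f x (c • y) := by
  obtain ⟨hx, hy, h⟩ := h
  refine ⟨hx, smul_ne_zero hc hy, h.trans ?_⟩
  rw [Projectivization.mk_eq_mk_iff']
  exact ⟨c⁻¹, by rw [smul_smul, inv_mul_cancel₀ hc, one_smul]⟩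

theorem smul_left (h : MapsVec f x y) {c : F} (hc : c ≠ 0) : MapsVec f (c • x) y := by
  simpa using (h.inv.smul_right hc).inv

theorem right_unique (h : MapsVec f x y) (h' : MapsVec f x y') : ∃ c : F, c ≠ 0 ∧ y' = c • y := by
  obtain ⟨hx, hy, h⟩ := h
  obtain ⟨_, hy', h'⟩ := h'
  obtain ⟨c, hc⟩ := (Projectivization.mk_eq_mk_iff' F _ _ hy' hy).1 (h'.symm.trans h)
  refine ⟨c, ?_, hc.symm⟩
  rintro rfl
  exact hy' (by simpa using hc.symm)

theorem left_unique (h : MapsVec f x y) (h' : MapsVec f x' y) : ∃ c : F, c ≠ 0 ∧ x' = c • x :=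
  h.inv.right_unique h'.inv

theorem linearIndependent (h₁ : MapsVec f x₁ y₁) (h₂ : MapsVec f x₂ y₂)
    (hx : LinearIndependent F ![x₁, x₂]) : LinearIndependent F ![y₁, y₂] := by
  rw [LinearIndependent.pair_iff' h₁.right_ne_zero]
  rintro a rfl
  have ha : a ≠ 0 := by
    rintro rfl
    exact h₂.right_ne_zero (zero_smul _ _)
  obtain ⟨c, -, rfl⟩ := (h₁.smul_right ha).left_unique h₂
  exact (LinearIndependent.pair_iff' h₁.left_ne_zero).1 hx c rfl

/-- The image of the line through `x₁` and `x₂` is a plane `W` containing the independent vectors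
`y₁`, `y₂`, which therefore span it. -/
theorem smul_add_smul (hf : f ∈ projAut F V) (h₁ : MapsVec f x₁ y₁) (h₂ : MapsVec f x₂ y₂)
    (hx : LinearIndependent F ![x₁, x₂]) {a b : F} (hab : a • x₁ + b • x₂ ≠ 0) :
    ∃ c d : F, MapsVec f (a • x₁ + b • x₂) (c • y₁ + d • y₂) := by
  have hspan {z₁ z₂ : V} (hz : LinearIndependent F ![z₁, z₂]) :
      Module.finrank F (Submodule.span F {z₁, z₂}) = 2 := by
    rw [← Matrix.range_cons_cons_empty z₁ z₂ ![], finrank_span_eq_card hz, Fintype.card_fin]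
  have hline : IsProjLine {p : ℙ F V | p.submodule ≤ Submodule.span F {x₁, x₂}} :=
    ⟨_, hspan hx, rfl⟩
  obtain ⟨W, hW, hL⟩ := (hf _).2 hline
  have key {x y : V} (h : MapsVec f x y) (hxs : x ∈ Submodule.span F {x₁, x₂}) : y ∈ W := by
    obtain ⟨hx0, hy0, h⟩ := h
    have : Projectivization.mk F y hy0 ∈
        f '' {p : ℙ F V | p.submodule ≤ Submodule.span F {x₁, x₂}} :=
      ⟨_, by simpa [Projectivization.submodule_mk, Submodule.span_singleton_le_iff_mem] using hxs, h⟩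
    rw [hL] at this
    simpa [Projectivization.submodule_mk, Submodule.span_singleton_le_iff_mem] using this
  have hWfin : FiniteDimensional F W := Module.finite_of_finrank_pos (by omega)
  have hle : Submodule.span F {y₁, y₂} ≤ W := by
    rw [Submodule.span_le, Set.insert_subset_iff, Set.singleton_subset_iff]
    exact ⟨key h₁ (Submodule.subset_span (by simp)), key h₂ (Submodule.subset_span (by simp))⟩
  have heq : Submodule.span F {y₁, y₂} = W :=
    Submodule.eq_of_le_of_finrank_eq hle (by rw [hW, hspan (h₁.linearIndependent h₂ hx)])
  obtain ⟨z, hz⟩ := exists_right f hab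
  have hzW := key hz (Submodule.mem_span_pair.2 ⟨a, b, rfl⟩)
  rw [← heq, Submodule.mem_span_pair] at hzW
  obtain ⟨c, d, rfl⟩ := hzW
  exact ⟨c, d, hz⟩

theorem exists_left_smul_add_smul (hf : f ∈ projAut F V) (h₁ : MapsVec f x₁ y₁)
    (h₂ : MapsVec f x₂ y₂) (hx : LinearIndependent F ![x₁, x₂]) {c d : F}
    (hcd : c • y₁ + d • y₂ ≠ 0) :
    ∃ a b : F, MapsVec f (a • x₁ + b • x₂) (c • y₁ + d • y₂) := by
  obtain ⟨a, b, h⟩ := smul_add_smul (inv_mem hf) h₁.inv h₂.inv (h₁.linearIndependent h₂ hx) hcd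
  exact ⟨a, b, by simpa using h.inv⟩

end MapsVec

/-! ### Affine charts and the fundamental theorem -/

/-- The data of an affine chart: `f` maps the point of `u` to that of `w`, and `φ` describes both
the action on the hyperplane `ker l` and the action on its complement. -/
structure AffineChart (f : Equiv.Perm (ℙ F V)) (l : V →ₗ[F] F) (u w : V) (φ : V → V) : Prop where
  mem : f ∈ projAut F V
  apply_eq_one : l u = 1
  base : MapsVec f u w
  map_zero : φ 0 = 0
  inf : ∀ v, l v = 0 → v ≠ 0 → MapsVec f v (φ v)
  aff : ∀ v, l v = 0 → v ≠ 0 → MapsVec f (u + v) (w + φ v)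

theorem linearIndependent_of_apply {l : V →ₗ[F] F} {u v : V} (hu : l u = 1) (hv : l v = 0)
    (hv0 : v ≠ 0) : LinearIndependent F ![u, v] := by
  rw [LinearIndependent.pair_iff]
  intro s t h
  have hs : s = 0 := by simpa [hu, hv] using congrArg l h
  subst hs
  exact ⟨rfl, by simpa [hv0] using h⟩

/-- The point of `u + v` goes to that of some `a • w + b • v'`. Both coefficients are nonzero
because this point differs from those of `u` and `v`, so rescaling by `a⁻¹` leaves `w` plus a
multiple of `v'`, taken as `φ v`. -/
theorem exists_affineChart {f : Equiv.Perm (ℙ F V)} (hf : f ∈ projAut F V) {l : V →ₗ[F] F}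
    {u : V} (hu : l u = 1) : ∃ w φ, AffineChart f l u w φ := by
  have hu0 : u ≠ 0 := by rintro rfl; simp at hu
  obtain ⟨w, hw⟩ := MapsVec.exists_right f hu0
  have key : ∀ v : V, ∃ y : V, (v = 0 → y = 0) ∧
      (l v = 0 → v ≠ 0 → MapsVec f v y ∧ MapsVec f (u + v) (w + y)) := by
    intro v
    by_cases hv : l v = 0 ∧ v ≠ 0
    · obtain ⟨hv, hv0⟩ := hv
      have hI := linearIndependent_of_apply hu hv hv0
      obtain ⟨v', hv'⟩ := MapsVec.exists_right f hv0
      have hne : (1 : F) • u + (1 : F) • v ≠ 0 := fun h => by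
        simpa using (LinearIndependent.pair_iff.1 hI _ _ h).1
      obtain ⟨a, b, hab⟩ := MapsVec.smul_add_smul hf hw hv' hI hne
      have ha : a ≠ 0 := by
        rintro rfl
        have hb : b ≠ 0 := by
          rintro rfl
          exact hab.right_ne_zero (by simp)
        rw [zero_smul, zero_add] at hab
        obtain ⟨c, -, hc⟩ := (hv'.smul_right hb).left_unique hab
        simpa [hu, hv] using congrArg l hc
      have hb : b ≠ 0 := by
        rintro rfl
        rw [zero_smul, add_zero] at hab
        obtain ⟨c, -, hc⟩ := (hw.smul_right ha).left_unique hab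
        have hc1 : 1 = c := by simpa [hu, hv] using congrArg l hc
        subst hc1
        exact hv0 (by simpa using hc)
      refine ⟨(a⁻¹ * b) • v', fun h => absurd h hv0, fun _ _ =>
        ⟨hv'.smul_right (mul_ne_zero (inv_ne_zero ha) hb), ?_⟩⟩
      have := hab.smul_right (inv_ne_zero ha)
      rwa [smul_add, smul_smul, smul_smul, inv_mul_cancel₀ ha, one_smul, one_smul, one_smul] at this
    · exact ⟨0, fun _ => rfl, fun h h' => absurd ⟨h, h'⟩ hv⟩
  choose φ h0 hφ using key
  exact ⟨w, φ, hf, hu, hw, h0 0 rfl, fun v h h' => (hφ v h h').1, fun v h h' => (hφ v h h').2⟩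

namespace AffineChart

variable {f : Equiv.Perm (ℙ F V)} {l : V →ₗ[F] F} {u w : V} {φ : V → V} {x y : V}

/-- If `w` were in the span of `φ x` and `φ y`, then pulling back along `f` would put `u` in the
span of `x` and `y`, hence in `ker l`. -/
theorem eq_zero_of_combination (h : AffineChart f l u w φ) (hx : l x = 0) (hy : l y = 0)
    (hxy : LinearIndependent F ![x, y]) {a b c : F} (h0 : a • w + b • φ x + c • φ y = 0) :
    a = 0 ∧ b = 0 ∧ c = 0 := by
  have hX := h.inf x hx (hxy.ne_zero 0)
  have hY := h.inf y hy (hxy.ne_zero 1)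
  have hφ := LinearIndependent.pair_iff.1 (hX.linearIndependent hY hxy)
  by_cases ha : a = 0
  · subst ha
    rw [zero_smul, zero_add] at h0
    exact ⟨rfl, hφ _ _ h0⟩
  · exfalso
    have hw : a • w = (-b) • φ x + (-c) • φ y := by
      rw [← sub_eq_zero, ← h0]; module
    have hW := h.base.smul_right ha
    have hne := hW.right_ne_zero
    rw [hw] at hW hne
    obtain ⟨s, t, hst⟩ := MapsVec.exists_left_smul_add_smul h.mem hX hY hxy hne
    obtain ⟨c, -, hc⟩ := hst.left_unique hW
    simpa [hx, hy, h.apply_eq_one] using congrArg l hc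

/-- The point of `u + x + y` lies on the line joining `u + x` to `y`, so in its image `w` and `φ x`
have equal coefficients. -/
theorem coeff_right (h : AffineChart f l u w φ) (hx : l x = 0) (hy : l y = 0)
    (hxy : LinearIndependent F ![x, y]) {s t : F} (hst : φ (x + y) = s • φ x + t • φ y) :
    s = 1 := by
  have hx0 : x ≠ 0 := hxy.ne_zero 0
  have hy0 : y ≠ 0 := hxy.ne_zero 1
  have hxy0 : x + y ≠ 0 := fun h0 => by
    simpa using (LinearIndependent.pair_iff.1 hxy 1 1 (by simpa using h0)).1
  have hI : LinearIndependent F ![u + x, y] :=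
    linearIndependent_of_apply (l := l) (by simp [hx, h.apply_eq_one]) hy hy0
  have hA := h.aff (x + y) (by simp [hx, hy]) hxy0
  have hne : (1 : F) • (u + x) + (1 : F) • y ≠ 0 := by
    rw [one_smul, one_smul, add_assoc]; exact hA.left_ne_zero
  obtain ⟨a, b, hab⟩ := MapsVec.smul_add_smul h.mem (h.aff x hx hx0) (h.inf y hy hy0) hI hne
  rw [one_smul, one_smul, add_assoc] at hab
  obtain ⟨c, -, hc⟩ := hab.right_unique hA
  rw [hst] at hc
  have : (1 - c * a) • w + (s - c * a) • φ x + (t - c * b) • φ y = 0 := by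
    rw [← sub_eq_zero] at hc
    rw [← hc]; module
  obtain ⟨h1, h2, -⟩ := h.eq_zero_of_combination hx hy hxy this
  linear_combination h2 - h1

theorem map_add_of_linearIndependent (h : AffineChart f l u w φ) (hx : l x = 0) (hy : l y = 0)
    (hxy : LinearIndependent F ![x, y]) : φ (x + y) = φ x + φ y := by
  have hx0 : x ≠ 0 := hxy.ne_zero 0
  have hy0 : y ≠ 0 := hxy.ne_zero 1
  have hxy0 : x + y ≠ 0 := fun h0 => by
    simpa using (LinearIndependent.pair_iff.1 hxy 1 1 (by simpa using h0)).1
  obtain ⟨a, b, hab⟩ := MapsVec.smul_add_smul h.mem (h.inf x hx hx0) (h.inf y hy hy0) hxy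
    (a := 1) (b := 1) (by simpa using hxy0)
  rw [one_smul, one_smul] at hab
  obtain ⟨c, -, hc⟩ := hab.right_unique (h.inf (x + y) (by simp [hx, hy]) hxy0)
  rw [smul_add, smul_smul, smul_smul] at hc
  have h1 := h.coeff_right hx hy hxy hc
  have h2 := h.coeff_right hy hx (LinearIndependent.pair_symm_iff.1 hxy)
    (s := c * b) (t := c * a) (by rw [add_comm y x, hc, add_comm])
  rw [hc, h1, h2, one_smul, one_smul]

theorem map_add (h : AffineChart f l u w φ)
    (hdim : ∀ x, l x = 0 → x ≠ 0 → ∃ z, l z = 0 ∧ LinearIndependent F ![x, z])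
    (hx : l x = 0) (hy : l y = 0) : φ (x + y) = φ x + φ y := by
  by_cases hx0 : x = 0
  · simp [hx0, h.map_zero]
  by_cases hxy : LinearIndependent F ![x, y]
  · exact h.map_add_of_linearIndependent hx hy hxy
  obtain ⟨c, rfl⟩ : ∃ c : F, c • x = y := by
    rw [LinearIndependent.pair_iff' hx0] at hxy
    push Not at hxy
    exact hxy
  -- For dependent vectors, `φ (x + c • x + z)` is expanded in two ways with `z` off the line of
  -- `x`.
  obtain ⟨z, hz, hxz⟩ := hdim x hx hx0
  have hp := LinearIndependent.pair_iff.1 hxz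
  have hxyz : LinearIndependent F ![x, c • x + z] := by
    rw [LinearIndependent.pair_iff]
    intro s t hst
    obtain ⟨h1, h2⟩ := hp (s + t * c) t (by rw [← hst]; module)
    subst h2
    exact ⟨by simpa using h1, rfl⟩
  have hmul : ∀ a : F, φ (a • x + z) = φ (a • x) + φ z := by
    intro a
    by_cases ha : a = 0
    · simp [ha, h.map_zero]
    refine h.map_add_of_linearIndependent (by simp [hx]) hz ?_
    rw [LinearIndependent.pair_iff]
    intro s t hst
    obtain ⟨h1, h2⟩ := hp (s * a) t (by rw [← hst]; module)
    exact ⟨by simpa [ha] using h1, h2⟩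
  have h1 := hmul (1 + c)
  have h2 := h.map_add_of_linearIndependent hx (by simp [hx, hz]) hxyz
  rw [hmul c, ← add_assoc] at h2
  rw [add_smul, one_smul] at h1
  rw [h1, ← add_assoc] at h2
  exact add_right_cancel h2

theorem exists_smul (h : AffineChart f l u w φ) (hx : l x = 0) (a : F) :
    ∃ c : F, φ (a • x) = c • φ x := by
  by_cases hx0 : x = 0
  · exact ⟨0, by simp [hx0, h.map_zero]⟩
  by_cases ha : a = 0
  · exact ⟨0, by simp [ha, h.map_zero]⟩
  obtain ⟨c, -, hc⟩ := ((h.inf x hx hx0).smul_left ha).right_unique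
    (h.inf (a • x) (by simp [hx]) (smul_ne_zero ha hx0))
  exact ⟨c, hc⟩

/-- Additivity at `a • (x + y)`, whose image is a multiple of `φ x + φ y`, forces equal factors on
`x` and `y`. -/
theorem smul_transfer (h : AffineChart f l u w φ)
    (hdim : ∀ x, l x = 0 → x ≠ 0 → ∃ z, l z = 0 ∧ LinearIndependent F ![x, z])
    (hx : l x = 0) (hy : l y = 0) (hxy : LinearIndependent F ![x, y]) {a c : F}
    (hc : φ (a • x) = c • φ x) : φ (a • y) = c • φ y := by
  obtain ⟨d, hd⟩ := h.exists_smul hy a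
  obtain ⟨e, he⟩ := h.exists_smul (x := x + y) (by simp [hx, hy]) a
  rw [smul_add, h.map_add hdim (by simp [hx]) (by simp [hy]), h.map_add hdim hx hy, hc, hd] at he
  have hI := (h.inf x hx (hxy.ne_zero 0)).linearIndependent (h.inf y hy (hxy.ne_zero 1)) hxy
  obtain ⟨h1, h2⟩ := LinearIndependent.pair_iff.1 hI (c - e) (d - e) (by
    rw [← sub_eq_zero] at he
    rw [← he]; module)
  rw [hd, show d = c by linear_combination h2 - h1]

theorem exists_ringEquiv (h : AffineChart f l u w φ)
    (hdim : ∀ x, l x = 0 → x ≠ 0 → ∃ z, l z = 0 ∧ LinearIndependent F ![x, z])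
    {v : V} (hv : l v = 0) (hv0 : v ≠ 0) :
    ∃ σ : F ≃+* F, ∀ (a : F) (x : V), l x = 0 → φ (a • x) = σ a • φ x := by
  choose σ hσ using h.exists_smul hv
  have hall (a : F) (x : V) (hx : l x = 0) : φ (a • x) = σ a • φ x := by
    by_cases hx0 : x = 0
    · simp [hx0, h.map_zero]
    by_cases hvx : LinearIndependent F ![v, x]
    · exact h.smul_transfer hdim hv hx hvx (hσ a)
    obtain ⟨c, rfl⟩ : ∃ c : F, c • v = x := by
      rw [LinearIndependent.pair_iff' hv0] at hvx
      push Not at hvx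
      exact hvx
    have hc : c ≠ 0 := by rintro rfl; simp at hx0
    -- Multiples of `v` are reached by two transfers, through an independent `z`.
    obtain ⟨z, hz, hvz⟩ := hdim v hv hv0
    refine h.smul_transfer hdim hz (by simp [hv]) ?_ (h.smul_transfer hdim hv hz hvz (hσ a))
    rw [LinearIndependent.pair_iff]
    intro s t hst
    obtain ⟨h1, h2⟩ := LinearIndependent.pair_iff.1 hvz (t * c) s (by rw [← hst]; module)
    exact ⟨h2, by simpa [hc] using h1⟩
  have hφv := h.inf v hv hv0
  have hinj {a b : F} (hab : a • φ v = b • φ v) : a = b :=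
    smul_left_injective F hφv.right_ne_zero hab
  have h1 : σ 1 = 1 := hinj (by rw [← hσ, one_smul, one_smul])
  have hmul (a b : F) : σ (a * b) = σ a * σ b := hinj (by
    rw [← hσ, mul_smul, hall a _ (by simp [hv]), hσ, smul_smul])
  have h0 : σ 0 = 0 := hinj (by rw [← hσ, zero_smul, zero_smul, h.map_zero])
  have hadd (a b : F) : σ (a + b) = σ a + σ b := hinj (by
    rw [← hσ, add_smul, h.map_add hdim (by simp [hv]) (by simp [hv]), hσ, hσ, add_smul])
  let s : F →+* F :=
    { toFun := σ, map_one' := h1, map_mul' := hmul, map_zero' := h0, map_add' := hadd }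
  -- A preimage of `c` is the affine coordinate `a⁻¹ * b` of the point that `f` sends to `w + c • φ
  -- v`.
  have hsurj : Function.Surjective s := by
    intro c
    by_cases hc : c = 0
    · exact ⟨0, by rw [hc, _root_.map_zero]⟩
    have hI := linearIndependent_of_apply h.apply_eq_one hv hv0
    have hI' := h.base.linearIndependent hφv hI
    have hne : (1 : F) • w + c • φ v ≠ 0 := fun h0 => by
      simpa using (LinearIndependent.pair_iff.1 hI' _ _ h0).1
    obtain ⟨a, b, hab⟩ := MapsVec.exists_left_smul_add_smul h.mem h.base hφv hI hne
    have ha : a ≠ 0 := by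
      rintro rfl
      have hb : b ≠ 0 := by rintro rfl; exact hab.left_ne_zero (by simp)
      rw [zero_smul, zero_add] at hab
      obtain ⟨d, -, hd⟩ := (hφv.smul_left hb).right_unique hab
      simpa using (LinearIndependent.pair_iff.1 hI' 1 (c - d) (by
        rw [← sub_eq_zero] at hd; rw [← hd]; module)).1
    have hb : b ≠ 0 := by
      rintro rfl
      rw [zero_smul, add_zero] at hab
      obtain ⟨d, -, hd⟩ := (h.base.smul_left ha).right_unique hab
      exact hc (LinearIndependent.pair_iff.1 hI' (1 - d) c (by
        rw [← sub_eq_zero] at hd; rw [← hd]; module)).2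
    have hab' := hab.smul_left (inv_ne_zero ha)
    rw [smul_add, smul_smul, smul_smul, inv_mul_cancel₀ ha, one_smul] at hab'
    have hA := h.aff ((a⁻¹ * b) • v) (by simp [hv])
      (smul_ne_zero (mul_ne_zero (inv_ne_zero ha) hb) hv0)
    rw [hσ] at hA
    obtain ⟨d, -, hd⟩ := hab'.right_unique hA
    obtain ⟨e1, e2⟩ := LinearIndependent.pair_iff.1 hI' (1 - d) (σ (a⁻¹ * b) - d * c) (by
      rw [← sub_eq_zero] at hd; rw [← hd]; module)
    exact ⟨a⁻¹ * b, show σ (a⁻¹ * b) = c by linear_combination e2 - c * e1⟩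
  exact ⟨RingEquiv.ofBijective s ⟨s.injective, hsurj⟩, hall⟩

end AffineChart

/-- The fundamental theorem of projective geometry: a collineation is induced by a semilinear
bijection. -/
theorem exists_semilinearMap_of_mem_projAut {f : Equiv.Perm (ℙ F V)} (hf : f ∈ projAut F V)
    {l : V →ₗ[F] F} {u v : V} (hu : l u = 1) (hv : l v = 0) (hv0 : v ≠ 0)
    (hdim : ∀ x, l x = 0 → x ≠ 0 → ∃ z, l z = 0 ∧ LinearIndependent F ![x, z]) :
    ∃ (σ : F ≃+* F) (T : V →ₛₗ[(σ : F →+* F)] V), Function.Bijective T ∧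
      ∀ x, x ≠ 0 → MapsVec f x (T x) := by
  obtain ⟨w, φ, h⟩ := exists_affineChart hf hu
  obtain ⟨σ, hσ⟩ := h.exists_ringEquiv hdim hv hv0
  have hl (x : V) : l (x - l x • u) = 0 := by simp [hu]
  let T : V →ₛₗ[(σ : F →+* F)] V :=
    { toFun := fun x => σ (l x) • w + φ (x - l x • u)
      map_add' := fun x y => by
        rw [show x + y - l (x + y) • u = (x - l x • u) + (y - l y • u) by
          rw [map_add]; module, h.map_add hdim (hl x) (hl y), map_add, map_add]
        module
      map_smul' := fun a x => by
        rw [show a • x - l (a • x) • u = a • (x - l x • u) by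
          rw [map_smul, smul_eq_mul]; module, hσ _ _ (hl x), map_smul, smul_eq_mul, map_mul]
        simp only [RingHom.coe_coe]
        module }
  have hTdef (x : V) : T x = σ (l x) • w + φ (x - l x • u) := rfl
  have hT (x : V) (hx : x ≠ 0) : MapsVec f x (T x) := by
    by_cases hlx : l x = 0
    · simpa [hTdef, hlx] using h.inf x hlx hx
    -- Off the hyperplane, `x` is scaled to `l x = 1`, where the chart applies.
    have hn : T ((l x)⁻¹ • x) = w + φ ((l x)⁻¹ • x - u) := by
      rw [hTdef, map_smul, smul_eq_mul, inv_mul_cancel₀ hlx, map_one, one_smul, one_smul]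
    have hm : MapsVec f ((l x)⁻¹ • x) (T ((l x)⁻¹ • x)) := by
      rw [hn]
      by_cases h0 : (l x)⁻¹ • x - u = 0
      · rw [h0, h.map_zero, add_zero, sub_eq_zero.1 h0]
        exact h.base
      · have := h.aff ((l x)⁻¹ • x - u) (by simp [hu, hlx]) h0
        rwa [add_sub_cancel] at this
    have := (hm.smul_left hlx).smul_right (c := σ (l x)) (by simpa using hlx)
    rw [map_smulₛₗ, smul_smul, smul_smul, mul_inv_cancel₀ hlx, one_smul] at this
    simpa [hlx] using this
  have hinj : Function.Injective T := by
    rw [injective_iff_map_eq_zero]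
    intro x hx
    by_contra hx0
    exact (hT x hx0).right_ne_zero hx
  have hsurj : Function.Surjective T := by
    intro y
    by_cases hy : y = 0
    · exact ⟨0, by simp [hy]⟩
    obtain ⟨x, hx⟩ := MapsVec.exists_left f hy
    obtain ⟨c, -, hc⟩ := (hT x hx.left_ne_zero).right_unique hx
    exact ⟨σ.symm c • x, by rw [map_smulₛₗ, hc]; simp⟩
  exact ⟨σ, T, ⟨hinj, hsurj⟩, hT⟩

end FundamentalTheorem

/-! ### Eigenvectors in odd dimension and points of agreement -/

theorem exists_eigenvector_of_odd_finrank {F V : Type*} [Field F] [AddCommGroup V] [Module F V]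
    [FiniteDimensional F V]
    (hF : ∀ p : Polynomial F, Odd p.natDegree → ∃ x, p.IsRoot x)
    (hV : Odd (Module.finrank F V)) (L : V →ₗ[F] V) : ∃ (c : F) (x : V), x ≠ 0 ∧ L x = c • x := by
  obtain ⟨c, hc⟩ := hF L.charpoly (by rwa [LinearMap.charpoly_natDegree])
  obtain ⟨x, hx⟩ :=
    ((Module.End.hasEigenvalue_iff_isRoot_charpoly L c).2 hc).exists_hasEigenvector
  exact ⟨c, x, hx.2, hx.apply_eq_smul⟩

/-- Real irreducible polynomials have degree at most two; a linear factor gives a root, and removing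
a quadratic one preserves odd degree. -/
theorem Real.exists_isRoot_of_odd_natDegree (p : Polynomial ℝ) (hp : Odd p.natDegree) :
    ∃ x, p.IsRoot x := by
  have hp0 : p ≠ 0 := by rintro rfl; simp at hp
  induction hn : p.natDegree using Nat.strong_induction_on generalizing p with
  | _ n ih =>
  obtain ⟨q, hq, r, rfl⟩ := Polynomial.exists_irreducible_of_natDegree_pos (f := p) hp.pos
  have hq0 := hq.ne_zero
  have hr0 : r ≠ 0 := right_ne_zero_of_mul hp0
  have hq2 := hq.natDegree_le_two
  have hq1 := hq.natDegree_pos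
  rw [Polynomial.natDegree_mul hq0 hr0] at hp hn
  obtain h1 | h2 : q.natDegree = 1 ∨ q.natDegree = 2 := by omega
  · obtain ⟨x, hx⟩ := Polynomial.exists_root_of_degree_eq_one
      ((Polynomial.degree_eq_iff_natDegree_eq_of_pos one_pos).2 h1)
    exact ⟨x, by simp [hx.eq_zero, Polynomial.IsRoot]⟩
  · obtain ⟨x, hx⟩ := ih r.natDegree (by omega) r (by grind) hr0 rfl
    exact ⟨x, by simp [hx.eq_zero, Polynomial.IsRoot]⟩

/-- Two collineations of an even-dimensional projective space with the same companion automorphism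
agree at some point. -/
theorem exists_apply_eq_of_semilinear {F V : Type*} [Field F] [AddCommGroup V] [Module F V]
    [FiniteDimensional F V] (hF : ∀ p : Polynomial F, Odd p.natDegree → ∃ x, p.IsRoot x)
    (hV : Odd (Module.finrank F V)) {f g : Equiv.Perm (ℙ F V)} {σ τ : F ≃+* F}
    (hστ : σ = τ) {T : V →ₛₗ[(σ : F →+* F)] V} {U : V →ₛₗ[(τ : F →+* F)] V}
    (hU : Function.Bijective U)
    (hfT : ∀ x, x ≠ 0 → MapsVec f x (T x)) (hgU : ∀ x, x ≠ 0 → MapsVec g x (U x)) :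
    ∃ p, f p = g p := by
  subst hστ
  have hinv := Function.rightInverse_surjInv hU.surjective
  -- `U⁻¹ ∘ T` is linear because the two companions cancel.
  let L : V →ₗ[F] V :=
    { toFun := fun x => Function.surjInv hU.surjective (T x)
      map_add' := fun x y => hU.injective (by rw [hinv, map_add, map_add, hinv, hinv])
      map_smul' := fun a x => hU.injective (by
        rw [hinv, map_smulₛₗ, RingHom.id_apply, map_smulₛₗ, hinv]) }
  obtain ⟨c, x, hx, hL⟩ := exists_eigenvector_of_odd_finrank hF hV L
  have hTU : T x = U (c • x) := by rw [← hL]; exact (hinv _).symm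
  obtain ⟨_, hy, hf⟩ := hfT x hx
  obtain ⟨_, hz, hg⟩ := hgU x hx
  refine ⟨Projectivization.mk F x hx, ?_⟩
  rw [hf, hg, Projectivization.mk_eq_mk_iff']
  exact ⟨σ c, by rw [hTU, map_smulₛₗ]; rfl⟩

/-! ### Counting companions in a Singer group -/

theorem exists_injective_projectivization {F V : Type*} [Field F] [AddCommGroup V] [Module F V]
    {l : V →ₗ[F] F} {u v : V} (hu : l u = 1) (hv : l v = 0) (hv0 : v ≠ 0) :
    ∃ i : F → ℙ F V, Function.Injective i := by
  have hne (a : F) : u + a • v ≠ 0 := fun h => by simpa [hu, hv] using congrArg l h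
  refine ⟨fun a => Projectivization.mk F _ (hne a), fun a b hab => ?_⟩
  obtain ⟨c, hc⟩ := (Projectivization.mk_eq_mk_iff' F _ _ _ _).1 hab
  have h1 : c = 1 := by simpa [hu, hv] using congrArg l hc
  subst h1
  rw [one_smul, add_right_inj] at hc
  exact (smul_left_injective F hv0 hc).symm

/-- A projective space of even dimension `m ≥ 2` over a field `F` in which odd-degree polynomials
have roots has no Singer group if `F` has fewer automorphisms than elements. -/
theorem not_pgHasSingerGroup {F : Type*} [Field F]
    (hF : ∀ p : Polynomial F, Odd p.natDegree → ∃ x, p.IsRoot x)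
    (hcard : Cardinal.mk (F ≃+* F) < Cardinal.mk F) {m : ℕ} (hm : 2 ≤ m) (hme : Even m) :
    ¬ PGHasSingerGroup m F := by
  rintro ⟨S, hS⟩
  obtain ⟨k, rfl⟩ : ∃ k, m = k + 2 := ⟨m - 2, by omega⟩
  let l : (Fin (k + 2 + 1) → F) →ₗ[F] F := LinearMap.proj 0
  have hu : l (Pi.single 0 1) = 1 := by simp [l]
  have hsingle (i : Fin (k + 2 + 1)) (hi : i ≠ 0) : l (Pi.single i 1) = 0 := by
    simp [l, hi.symm]
  have hdim (x : Fin (k + 2 + 1) → F) (hx : l x = 0) (hx0 : x ≠ 0) :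
      ∃ z, l z = 0 ∧ LinearIndependent F ![x, z] := by
    obtain ⟨i, hi⟩ := Function.ne_iff.1 hx0
    have hi0 : i ≠ 0 := by rintro rfl; exact hi hx
    -- Three coordinates are available, so some `j` avoids both `0` and `i`; this is where `2 ≤ m`
    -- enters.
    obtain ⟨j, hj0, hji⟩ : ∃ j : Fin (k + 2 + 1), j ≠ 0 ∧ j ≠ i := by
      by_cases h : i = 1
      · exact ⟨2, by simp [Fin.ext_iff, Nat.mod_eq_of_lt], by simp [h, Fin.ext_iff, Nat.mod_eq_of_lt]⟩
      · exact ⟨1, by simp, Ne.symm h⟩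
    refine ⟨Pi.single j 1, hsingle j hj0, ?_⟩
    rw [LinearIndependent.pair_iff' hx0]
    intro a ha
    have hai := congrFun ha i
    have haj := congrFun ha j
    have ha0 : a = 0 := by simpa [hji.symm, show x i ≠ 0 from hi] using hai
    simp [ha0] at haj
  have hv := hsingle 1 (by simp)
  have hv0 : (Pi.single 1 1 : Fin (k + 2 + 1) → F) ≠ 0 := by simp
  obtain ⟨i, hi⟩ := exists_injective_projectivization hu hv hv0
  choose σ T hT hTf using fun g : projAut F (Fin (k + 2 + 1) → F) =>
    exists_semilinearMap_of_mem_projAut g.2 hu hv hv0 hdim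
  choose s hs using fun q => (hS (i 0) q).exists
  -- It suffices that the companion of the element taking `i 0` to `i a` determines `a`.
  refine hcard.not_ge (Cardinal.mk_le_of_injective (f := fun a => σ (s (i a))) fun a b hab => ?_)
  obtain ⟨p, hp⟩ := exists_apply_eq_of_semilinear hF (by simpa using hme.add_one) hab
    (hT (s (i b))) (hTf (s (i a))) (hTf (s (i b)))
  have hab : s (i a) = s (i b) :=
    (hS p _).unique ⟨(hs (i a)).1, rfl⟩ ⟨(hs (i b)).1, hp.symm⟩
  have h1 := (hs (i a)).2
  rw [hab, (hs (i b)).2] at h1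
  exact (hi h1).symm

/-- The identity is the only ring endomorphism of `ℝ`. -/
theorem Real.mk_ringAut_lt : Cardinal.mk (ℝ ≃+* ℝ) < Cardinal.mk ℝ := by
  have : Subsingleton (ℝ ≃+* ℝ) :=
    ⟨fun a b => RingEquiv.toRingHom_injective (Subsingleton.elim _ _)⟩
  exact (Cardinal.le_one_iff_subsingleton.2 this).trans_lt
    (Cardinal.one_lt_iff_nontrivial.2 inferInstance)

theorem mainTheorem6 :
    (∀ (F : Type*) [Field F] [IsRealClosed F],
        Cardinal.mk (F ≃+* F) < Cardinal.mk F →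
          ∀ n : ℕ, 3 ≤ n → Odd n → ¬ PGHasSingerGroup (n - 1) F) ∧
      ¬ PGHasSingerGroup 2 ℝ ∧
      ∀ m : ℕ, 2 ≤ m → Even m → ¬ PGHasSingerGroup m ℝ := by
  have hR (m : ℕ) (hm : 2 ≤ m) (hme : Even m) : ¬ PGHasSingerGroup m ℝ :=
    not_pgHasSingerGroup Real.exists_isRoot_of_odd_natDegree Real.mk_ringAut_lt hm hme
  refine ⟨fun F _ _ hcard n hn hodd => ?_, hR 2 le_rfl even_two, hR⟩
  exact not_pgHasSingerGroup (fun p hp => IsRealClosed.exists_isRoot_of_odd_natDegree hp) hcard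
    (by omega) (hodd.tsub_odd odd_one)
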